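/- Let $D\subset\mathbb{C}$ be a non-empty open set, let $\Omega\subset\mathbb{C}$ be a domain (a non-empty connected open set) with $D\subset\Omega$, and let $f:D\to D$ be holomorphic, with iterates $f^1=f$, $f^{n+1}=f\circ f^{n}$. Let $\mathbb{C}_\infty=\mathbb{C}\cup\{\infty\}$ be the extended complex plane with the chordal metric, and let $\partial_\infty\Omega$ be the boundary of $\Omega$ in $\mathbb{C}_\infty$. Suppose that - $D$ has no holes, i.e. every connected component of $\mathbb{C}_\infty\setminus D$ contains $\infty$; - $f$ is injective on $D$; - $f^n\to\partial_\infty\Omega$ locally uniformly on $D$, i.e. the functions $z\mapsto\operatorname{dist}(f^n(z),\partial_\infty\Omega)$, where $\operatorname{dist}$ is the chordal distance, converge to $0$ locally uniformly on $D$ as $n\to\infty$. For an open set $U\subset\mathbb{C}$ let $H(U)$ be the space of holomorphic functions $U\to\mathbb{C}$ with the topology of locally uniform convergence. A function $g\in H(\Omega)$ is called $H(D)$-universal for the composition operator $C_f$ if every element of $H(D)$ lies in the closure of $\{g\circ f^n:n\ge 1\}$, i.e. if $\{g\circ f^n : n\geq 1\}$ is dense in $H(D)$. Then the set of all $g\in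 H(\Omega)$ which are $H(D)$-universal for $C_f$ is comeager in $H(\Omega)$, i.e. it contains a dense $G_\delta$-subset of $H(\Omega)$. -/

import Mathlib

open Set Filter Topology

namespace HolUniversal

/-- A function on a (usually open) set `U ⊆ ℂ` is holomorphic: it is the restriction to `U` of a
function that is complex differentiable on `U`. -/
def IsHolo {U : Set ℂ} (g : U → ℂ) : Prop :=
  ∃ F : ℂ → ℂ, DifferentiableOn ℂ F U ∧ ∀ z : U, g z = F z

/-- `H(U)`, inside the space `C(U, ℂ)` with the compact-open topology, that is, the topology of
uniform convergence on compact subsets of `U`. The type `↥(H U)` carries the subspace topology. -/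
def H (U : Set ℂ) : Set C(U, ℂ) := {g | IsHolo g}

/-- A set `M ⊆ ℂ` regarded as a subset of the extended plane `ℂ_∞`. -/
def toSphere (M : Set ℂ) : Set (OnePoint ℂ) := (fun z : ℂ => (z : OnePoint ℂ)) '' M

/-- `A` is a hole of `M`: a connected component of `ℂ_∞ \ M` that does not contain `∞`. -/
def IsHole (M : Set ℂ) (A : Set (OnePoint ℂ)) : Prop :=
  (∃ x ∈ (toSphere M)ᶜ, A = connectedComponentIn (toSphere M)ᶜ x) ∧ OnePoint.infty ∉ A

def HasNoHoles (M : Set ℂ) : Prop := ∀ A : Set (OnePoint ℂ), ¬ IsHole M A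

/-- The boundary of `M ⊆ ℂ` in the extended plane `ℂ_∞`. -/
def sphereBoundary (M : Set ℂ) : Set (OnePoint ℂ) := frontier (toSphere M)

/-- The chordal metric on `ℂ_∞` (it induces the topology of `OnePoint ℂ`). -/
noncomputable def chordal : OnePoint ℂ → OnePoint ℂ → ℝ
  | none, none => 0
  | none, some w => 2 / √(1 + ‖w‖ ^ 2)
  | some z, none => 2 / √(1 + ‖z‖ ^ 2)
  | some z, some w => 2 * ‖z - w‖ / (√(1 + ‖z‖ ^ 2) * √(1 + ‖w‖ ^ 2))

/-- The chordal distance of a point from a (non-empty) set. -/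
noncomputable def chordalDist (x : OnePoint ℂ) (S : Set (OnePoint ℂ)) : ℝ :=
  sInf (chordal x '' S)

/-- The `n`-th iterate of a continuous self-map. -/
noncomputable def iter {D : Set ℂ} (f : C(D, D)) (n : ℕ) : C(D, D) := ⟨f^[n], f.continuous.iterate n⟩

/-- The sequence of iterates of `f` converges to the boundary of `Ω` in `ℂ_∞`, locally uniformly
on `D`. -/
def IteratesTendToBoundary {D : Set ℂ} (f : C(D, D)) (Ω : Set ℂ) : Prop :=
  TendstoLocallyUniformly
    (fun (n : ℕ) (z : D) => chordalDist ((iter f n z : ℂ) : OnePoint ℂ) (sphereBoundary Ω))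
    (fun _ => 0) atTop

/-- The function `g ∘ fⁿ|_M` for `M ⊆ D ⊆ Ω`, `f : D → D` and `g : Ω → ℂ`. -/
noncomputable def compIter {M D Ω : Set ℂ} (hM : M ⊆ D) (hD : D ⊆ Ω) (f : C(D, D)) (g : C(Ω, ℂ)) (n : ℕ) :
    C(M, ℂ) :=
  g.comp ((ContinuousMap.inclusion hD).comp ((iter f n).comp (ContinuousMap.inclusion hM)))

/-- `g` is `ℱ`-universal for the composition operator `C_f`, where `ℱ ⊆ C(M)`: the family `ℱ` lies
in the closure of `{g ∘ fⁿ|_M : n ≥ 1}` in `C(M)`. -/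
def IsUniversal {M D Ω : Set ℂ} (hM : M ⊆ D) (hD : D ⊆ Ω) (f : C(D, D)) (ℱ : Set C(M, ℂ))
    (g : H Ω) : Prop :=
  ℱ ⊆ closure {h : C(M, ℂ) | ∃ n : ℕ, 1 ≤ n ∧ h = compIter hM hD f g n}

/-- A set is comeager if it contains a dense `G_δ`-set. -/
def IsComeager {X : Type*} [TopologicalSpace X] (S : Set X) : Prop :=
  ∃ G : Set X, G ⊆ S ∧ IsGδ G ∧ Dense G

end HolUniversal

/-! This is a Baire category argument. For each basic open `V` of `C(D, ℂ)` meeting `H D`, the set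
of `g` with some `g ∘ fⁿ` in `V` is open. It is dense by `exists_compIter_mem`, and `H Ω` is a Baire
space.

For density, let `K ⊆ Ω` and `L ⊆ D` be compact. For large `n` the set `M = fⁿ(L)` misses `K`, and
by injectivity `fⁿ` has a holomorphic inverse `φ` on `fⁿ(D)`. The function equal to `g` near `K` and
to `h ∘ φ` near `M` must be approximated on `X = K ∪ M` by functions holomorphic on `Ω`
(`exists_approx_of_disjoint`).

This Runge-type step takes place in a closed subalgebra `A` of `C(X, ℂ)`. By the Cauchy–Pompeiu
formula it suffices that `(z - a)⁻¹ ∈ A` for `a ∉ X` (`mem_of_differentiableOn`), i.e. that the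
spectrum of the coordinate in `A` lies in `X`. Its frontier always does. A point `a` of the spectrum
outside `X` would thus lie in a bounded open set with frontier in `X`, which a continuous logarithm
of `z - a` on `X` excludes by a winding number argument (`exists_inv_of_hasLogOn`).

Logarithms thus replace the topology of holes. They exist on `L` because `D` has no holes, and they
pass to `M` because zero-free holomorphic functions near `L` also have logarithms on `L`
(`hasLogOn_of_differentiableOn`). -/

namespace HolUniversal

/-! ### Continuous logarithms -/

/-- `F` has a continuous logarithm on `S`. -/
def HasLogOn (S : Set ℂ) (F : ℂ → ℂ) : Prop :=
  ∃ l : ℂ → ℂ, ContinuousOn l S ∧ ∀ z ∈ S, Complex.exp (l z) = F z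

namespace HasLogOn

variable {S T : Set ℂ} {F G : ℂ → ℂ}

theorem congr (h : HasLogOn S F) (hFG : ∀ z ∈ S, F z = G z) : HasLogOn S G := by
  obtain ⟨l, hl, he⟩ := h
  exact ⟨l, hl, fun z hz => (he z hz).trans (hFG z hz)⟩

theorem mul (hF : HasLogOn S F) (hG : HasLogOn S G) : HasLogOn S (fun z => F z * G z) := by
  obtain ⟨l, hl, he⟩ := hF
  obtain ⟨m, hm, he'⟩ := hG
  exact ⟨fun z => l z + m z, hl.add hm, fun z hz => by rw [Complex.exp_add, he z hz, he' z hz]⟩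

theorem div (hF : HasLogOn S F) (hG : HasLogOn S G) : HasLogOn S (fun z => F z / G z) := by
  obtain ⟨l, hl, he⟩ := hF
  obtain ⟨m, hm, he'⟩ := hG
  exact ⟨fun z => l z - m z, hl.sub hm, fun z hz => by rw [Complex.exp_sub, he z hz, he' z hz]⟩

theorem const {c : ℂ} (hc : c ≠ 0) : HasLogOn S (fun _ => c) :=
  ⟨fun _ => Complex.log c, continuousOn_const, fun _ _ => Complex.exp_log hc⟩

theorem of_mem_slitPlane (hF : ContinuousOn F S) (h : ∀ z ∈ S, F z ∈ Complex.slitPlane) :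
    HasLogOn S F :=
  ⟨fun z => Complex.log (F z), hF.clog h,
    fun z hz => Complex.exp_log (Complex.slitPlane_ne_zero (h z hz))⟩

theorem of_norm_sub_one_lt (hF : ContinuousOn F S) (h : ∀ z ∈ S, ‖F z - 1‖ < 1) :
    HasLogOn S F :=
  of_mem_slitPlane hF fun z hz =>
    Complex.ball_one_subset_slitPlane (by simpa [dist_eq_norm] using h z hz)

/-- As in Rouché's theorem, `G / F` stays in the unit disc about `1`, where the principal logarithm
is continuous. -/
theorem of_norm_sub_lt (hF : HasLogOn S F) (hFc : ContinuousOn F S) (hG : ContinuousOn G S)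
    (h : ∀ z ∈ S, ‖G z - F z‖ < ‖F z‖) : HasLogOn S G := by
  have h0 : ∀ z ∈ S, F z ≠ 0 := fun z hz =>
    norm_pos_iff.1 ((norm_nonneg _).trans_lt (h z hz))
  have h1 : HasLogOn S (fun z => G z / F z) := by
    refine of_norm_sub_one_lt (hG.div hFc h0) fun z hz => ?_
    rw [div_sub_one (h0 z hz), norm_div, div_lt_one (norm_pos_iff.2 (h0 z hz))]
    exact h z hz
  exact (hF.mul h1).congr fun z hz => mul_div_cancel₀ _ (h0 z hz)

theorem union (hS : IsClosed S) (hT : IsClosed T) (hd : Disjoint S T) (h1 : HasLogOn S F)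
    (h2 : HasLogOn T F) : HasLogOn (S ∪ T) F := by
  classical
  obtain ⟨l, hl, he⟩ := h1
  obtain ⟨m, hm, he'⟩ := h2
  have e1 : EqOn (S.piecewise l m) l S := piecewise_eqOn _ _ _
  have e2 : EqOn (S.piecewise l m) m T :=
    (piecewise_eqOn_compl _ _ _).mono hd.subset_compl_left
  refine ⟨S.piecewise l m, (hl.congr e1).union_of_isClosed (hm.congr e2) hS hT, ?_⟩
  rintro z (hz | hz)
  · rw [e1 hz, he z hz]
  · rw [e2 hz, he' z hz]

theorem sub_of_norm_lt {a : ℂ} (h : ∀ z ∈ S, ‖z‖ < ‖a‖) : HasLogOn S (fun z => z - a) := by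
  rcases S.eq_empty_or_nonempty with rfl | ⟨w, hw⟩
  · exact ⟨0, by simp, by simp⟩
  have ha : -a ≠ 0 := neg_ne_zero.2 (norm_pos_iff.1 ((norm_nonneg _).trans_lt (h w hw)))
  refine (const ha).of_norm_sub_lt continuousOn_const (by fun_prop) fun z hz => ?_
  simpa using h z hz

theorem sub_of_sub {a b : ℂ} (hb : HasLogOn S (fun z => z - b))
    (h : ∀ z ∈ S, ‖a - b‖ < ‖z - b‖) : HasLogOn S (fun z => z - a) := by
  refine hb.of_norm_sub_lt (by fun_prop) (by fun_prop) fun z hz => ?_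
  have : z - a - (z - b) = -(a - b) := by ring
  rw [this, norm_neg]
  exact h z hz

theorem div_of_norm_lt {a b : ℂ} (h : ∀ z ∈ S, ‖a - b‖ < ‖z - b‖) :
    HasLogOn S (fun z => (z - a) / (z - b)) := by
  have h0 : ∀ z ∈ S, z - b ≠ 0 := fun z hz =>
    norm_pos_iff.1 ((norm_nonneg _).trans_lt (h z hz))
  refine of_norm_sub_one_lt (ContinuousOn.div (by fun_prop) (by fun_prop) h0) fun z hz => ?_
  rw [div_sub_one (h0 z hz), norm_div, div_lt_one (norm_pos_iff.2 (h0 z hz))]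
  have : z - a - (z - b) = -(a - b) := by ring
  rw [this, norm_neg]
  exact h z hz

end HasLogOn

/-- Along the circle, the logarithm minus `i t` lifts the constant `R` through `exp`. It is
therefore constant, contradicting `2π`-periodicity of the circle map. -/
theorem not_hasLogOn_sphere (a : ℂ) {R : ℝ} (hR : 0 < R) :
    ¬ HasLogOn (Metric.sphere a R) (fun z => z - a) := by
  rintro ⟨l, hl, he⟩
  have hmem : ∀ t : ℝ, circleMap a R t ∈ Metric.sphere a R := circleMap_mem_sphere a hR.le
  have hc : Continuous fun t : ℝ => l (circleMap a R t) :=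
    hl.comp_continuous (continuous_circleMap a R) hmem
  set g₁ : ℝ → ℂ := fun t => l (circleMap a R t) - t * Complex.I with hg₁
  have hexp : ∀ t, Complex.exp (g₁ t) = R := by
    intro t
    rw [hg₁, Complex.exp_sub, he _ (hmem t)]
    simp [circleMap]
  have heq : g₁ = fun _ => g₁ 0 :=
    Complex.isCoveringMap_exp.eq_of_comp_eq (hc.sub (by fun_prop)) continuous_const
      (funext fun t => Subtype.ext (by simp [hexp])) 0 rfl
  have h1 := congrFun heq (2 * Real.pi)
  have h2 : circleMap a R (2 * Real.pi) = circleMap a R 0 := by simp [circleMap]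
  simp only [hg₁, h2] at h1
  have h3 : ((2 * Real.pi : ℝ) : ℂ) * Complex.I = ((0 : ℝ) : ℂ) * Complex.I :=
    sub_right_injective h1
  simp [Real.pi_ne_zero] at h3

/-- A quotient `(z - a) / q z` with `a` in a bounded open set `B` and `q` free of zeros in `B` has no
continuous logarithm on a closed set containing the boundary of `B`. -/
theorem not_hasLogOn_of_frontier_subset {B X : Set ℂ} (hX : IsClosed X)
    (hBb : Bornology.IsBounded B) (hBX : frontier B ⊆ X) {a : ℂ} (ha : a ∈ B)
    {q : ℂ → ℂ} (hq : Continuous q) (hqB : ∀ z ∈ B, q z ≠ 0) (hqX : ∀ z ∈ X, q z ≠ 0) :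
    ¬ HasLogOn X (fun z => (z - a) / q z) := by
  classical
  rintro ⟨l, hl, he⟩
  obtain ⟨m, hm⟩ := ContinuousMap.exists_restrict_eq hX
    (⟨X.domRestrict l, continuousOn_iff_continuous_domRestrict.1 hl⟩ : C(X, ℂ))
  have hmX : ∀ z ∈ X, m z = l z := fun z hz => congr($hm ⟨z, hz⟩)
  -- With `m` a Tietze extension of the logarithm, both branches agree on the frontier of `B`. So
  -- `r` is continuous and zero-free on the plane, hence has a logarithm, yet it equals `z - a` on a
  -- large circle.
  set r : ℂ → ℂ := fun z => if z ∈ B then q z * Complex.exp (m z) else z - a with hr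
  have hrc : Continuous r := by
    refine continuous_if (fun z hz => ?_) (by fun_prop) (by fun_prop)
    have hzX := hBX hz
    rw [hmX z hzX, he z hzX, mul_div_cancel₀ _ (hqX z hzX)]
  have hr0 : ∀ z, r z ≠ 0 := by
    intro z
    by_cases hz : z ∈ B
    · simpa [hr, hz] using hqB z hz
    · simp only [hr, hz, if_false]
      exact sub_ne_zero.2 fun h => hz (h ▸ ha)
  have hsc : IsSimplyConnected (univ : Set ℂ) := by
    have := convex_univ.contractibleSpace (univ_nonempty (α := ℂ))
    exact SimplyConnectedSpace.ofContractible _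
  obtain ⟨s, hs, hse⟩ := Complex.exists_continuousOn_eqOn_exp_comp hsc isOpen_univ
    hrc.continuousOn (by simpa using hr0)
  obtain ⟨R, hR⟩ := hBb.subset_ball a
  have hR0 : 0 < R := by
    have := hR ha
    simpa using this
  refine not_hasLogOn_sphere a hR0 ⟨s, hs.mono (subset_univ _), fun z hz => ?_⟩
  have hzB : z ∉ B := fun h => by
    have h1 := hR h
    rw [Metric.mem_ball, Metric.mem_sphere.1 hz] at h1
    exact lt_irrefl _ h1
  have := hse (mem_univ z)
  simpa [hr, hzB] using this

/-! ### The Cauchy–Pompeiu formula -/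

/-- Twice the Wirtinger derivative `∂u/∂z̄`. -/
noncomputable def dbar (u : ℂ → ℂ) (w : ℂ) : ℂ :=
  fderiv ℝ u w 1 + Complex.I * fderiv ℝ u w Complex.I

theorem dbar_eq_zero_of_differentiableAt {u : ℂ → ℂ} {w : ℂ} (h : DifferentiableAt ℂ u w) :
    dbar u w = 0 := by
  have h1 : fderiv ℝ u w = (fderiv ℂ u w).restrictScalars ℝ :=
    (h.hasFDerivAt.restrictScalars ℝ).fderiv
  have h2 : fderiv ℂ u w Complex.I = Complex.I * fderiv ℂ u w 1 := by
    rw [← smul_eq_mul, ← map_smul, smul_eq_mul, mul_one]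
  simp only [dbar, h1, ContinuousLinearMap.coe_restrictScalars', h2]
  rw [← mul_assoc, Complex.I_mul_I]
  ring

theorem dbar_congr {u v : ℂ → ℂ} {w : ℂ} (h : u =ᶠ[𝓝 w] v) : dbar u w = dbar v w := by
  simp only [dbar, h.fderiv_eq]

theorem continuous_dbar {u : ℂ → ℂ} (hu : ContDiff ℝ 1 u) : Continuous (dbar u) := by
  have h := hu.continuous_fderiv one_ne_zero
  unfold dbar
  fun_prop

/-- After the Jacobian cancels the modulus of `ζ⁻¹`, this splits the Cauchy–Pompeiu integrand into a
radial and an angular derivative. -/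
theorem dbar_polar (u : ℂ → ℂ) (w : ℂ) (t : ℝ) :
    (Complex.exp (t * Complex.I))⁻¹ * dbar u w =
      fderiv ℝ u w (Complex.exp (t * Complex.I)) +
        Complex.I * fderiv ℝ u w (Complex.I * Complex.exp (t * Complex.I)) := by
  have h1 : Complex.exp (t * Complex.I) =
      (Real.cos t) • (1 : ℂ) + (Real.sin t) • Complex.I := by
    rw [Complex.exp_mul_I]
    simp
  have h2 : Complex.I * Complex.exp (t * Complex.I) =
      (-Real.sin t) • (1 : ℂ) + (Real.cos t) • Complex.I := by
    rw [Complex.exp_mul_I, mul_add, ← mul_assoc, mul_comm Complex.I (Complex.sin t), mul_assoc,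
      Complex.I_mul_I]
    simp
    ring
  have h3 : (Complex.exp (t * Complex.I))⁻¹ = Real.cos t - Real.sin t * Complex.I := by
    rw [← Complex.exp_neg, ← neg_mul, Complex.exp_mul_I]
    simp [sub_eq_add_neg]
  rw [h3, h2, h1]
  simp only [map_add, map_smul, dbar]
  simp only [Complex.real_smul, Complex.ofReal_neg]
  linear_combination (-(Real.sin t : ℂ) * fderiv ℝ u w Complex.I) * Complex.I_mul_I

open MeasureTheory in
-- In polar coordinates about `z`, the radial part integrates to `-u z` along each ray and the
-- angular part to zero over each circle.
theorem integral_inv_mul_dbar {u : ℂ → ℂ} (hu : ContDiff ℝ 1 u) (hc : HasCompactSupport u)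
    (z : ℂ) : ∫ ζ, ζ⁻¹ * dbar u (z + ζ) = -(2 * Real.pi * u z) := by
  have hud : Differentiable ℝ u := hu.differentiable one_ne_zero
  have hdu : Continuous (fderiv ℝ u) := hu.continuous_fderiv one_ne_zero
  have hduc : HasCompactSupport (fderiv ℝ u) := hc.fderiv ℝ
  obtain ⟨R, hR⟩ : ∃ R : ℝ, ∀ ζ : ℂ, R < ‖ζ‖ → fderiv ℝ u (z + ζ) = 0 := by
    obtain ⟨R, hR⟩ := hduc.isCompact.isBounded.subset_closedBall z
    refine ⟨R, fun ζ hζ => image_eq_zero_of_notMem_tsupport fun h => ?_⟩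
    have := hR h
    rw [mem_closedBall_iff_norm, add_sub_cancel_left] at this
    exact absurd hζ this.not_gt
  obtain ⟨R', hR'⟩ : ∃ R : ℝ, ∀ ζ : ℂ, R < ‖ζ‖ → u (z + ζ) = 0 := by
    obtain ⟨R, hR⟩ := hc.isCompact.isBounded.subset_closedBall z
    refine ⟨R, fun ζ hζ => image_eq_zero_of_notMem_tsupport fun h => ?_⟩
    have := hR h
    rw [mem_closedBall_iff_norm, add_sub_cancel_left] at this
    exact absurd hζ this.not_gt
  let e : ℝ → ℂ := fun t => Complex.exp (t * Complex.I)
  have hec : Continuous e := by fun_prop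
  have hen : ∀ t, ‖e t‖ = 1 := fun t => Complex.norm_exp_ofReal_mul_I t
  let A : ℝ × ℝ → ℂ := fun p => fderiv ℝ u (z + p.1 * e p.2) (e p.2)
  let B : ℝ × ℝ → ℂ := fun p => fderiv ℝ u (z + p.1 * e p.2) (Complex.I * e p.2)
  have hAc : Continuous A := by
    have : Continuous fun p : ℝ × ℝ => z + p.1 * e p.2 := by fun_prop
    exact (hdu.comp this).clm_apply (by fun_prop)
  have hBc : Continuous B := by
    have : Continuous fun p : ℝ × ℝ => z + p.1 * e p.2 := by fun_prop
    exact (hdu.comp this).clm_apply (by fun_prop)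
  have hpol : polarCoord.target = Ioi (0 : ℝ) ×ˢ Ioo (-Real.pi) Real.pi := rfl
  have key : ∀ C : ℝ × ℝ → ℂ, Continuous C → (∀ p : ℝ × ℝ, R < p.1 → C p = 0) →
      IntegrableOn C (Ioi (0 : ℝ) ×ˢ Ioo (-Real.pi) Real.pi) (volume.prod volume) := by
    intro C hC h0
    have h1 : IntegrableOn C (Icc (0 : ℝ) R ×ˢ Icc (-Real.pi) Real.pi) (volume.prod volume) :=
      hC.continuousOn.integrableOn_compact (isCompact_Icc.prod isCompact_Icc)
    refine IntegrableOn.of_forall_sdiff_eq_zero (h1.mono_set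
      (inter_subset_left (t := Ioi (0:ℝ) ×ˢ Ioo (-Real.pi) Real.pi)))
      (measurableSet_Ioi.prod measurableSet_Ioo) ?_
    rintro ⟨r, t⟩ ⟨⟨hr, ht⟩, hn⟩
    refine h0 _ (not_le.1 fun hle => hn ⟨⟨⟨le_of_lt hr, hle⟩, Ioo_subset_Icc_self ht⟩, hr, ht⟩)
  have hA0 : ∀ p : ℝ × ℝ, R < p.1 → fderiv ℝ u (z + p.1 * e p.2) = 0 := by
    intro p hp
    refine hR _ (hp.trans_le ?_)
    rw [norm_mul, hen, mul_one, Complex.norm_real]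
    exact le_abs_self _
  have hAi := key A hAc fun p hp => by simp [A, hA0 p hp]
  have hBi := key B hBc fun p hp => by simp [B, hA0 p hp]
  have hAint : ∫ p in Ioi (0 : ℝ) ×ˢ Ioo (-Real.pi) Real.pi, A p = -(2 * Real.pi * u z) := by
    have h1 : ∀ t : ℝ, ∫ r in Ioi (0 : ℝ), A (r, t) = -u z := by
      intro t
      have hd : ∀ r : ℝ, HasDerivAt (fun r : ℝ => u (z + r * e t)) (A (r, t)) r := by
        intro r
        have h2 : HasDerivAt (fun r : ℝ => z + r * e t) (e t) r := by
          simpa using ((Complex.ofRealCLM.hasDerivAt (x := r)).mul_const (e t)).const_add z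
        exact (hud _).hasFDerivAt.comp_hasDerivAt r h2
      have h3 := integral_Ioi_of_hasDerivAt_of_tendsto (a := (0 : ℝ)) (m := 0)
        (hd 0).continuousAt.continuousWithinAt (fun r _ => hd r) ?_ ?_
      · simpa using h3
      · have h1 : IntegrableOn (fun r => A (r, t)) (Icc (0 : ℝ) R) volume :=
          (hAc.comp (by fun_prop : Continuous fun r : ℝ => (r, t))).continuousOn.integrableOn_compact
            isCompact_Icc
        refine IntegrableOn.of_forall_sdiff_eq_zero (h1.mono_set (inter_subset_left (t := Ioi 0)))
          measurableSet_Ioi ?_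
        rintro r ⟨hr, hn⟩
        have : R < r := not_le.1 fun hle => hn ⟨⟨le_of_lt hr, hle⟩, hr⟩
        simp [A, hA0 (r, t) this]
      · refine tendsto_const_nhds.congr' ?_
        filter_upwards [eventually_gt_atTop R'] with r hr
        refine (hR' _ (hr.trans_le ?_)).symm
        rw [norm_mul, hen, mul_one, Complex.norm_real]
        exact le_abs_self _
    -- The swap makes the radial integral the inner one in Fubini.
    have h4 := setIntegral_prod_swap (Ioi (0 : ℝ)) (Ioo (-Real.pi) Real.pi)
      (fun p : ℝ × ℝ => A p) (μ := (volume : Measure ℝ)) (ν := (volume : Measure ℝ))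
    rw [Measure.volume_eq_prod, ← h4, setIntegral_prod (fun p : ℝ × ℝ => A p.swap) hAi.swap]
    simp only [Prod.swap_prod_mk, h1]
    rw [setIntegral_const]
    simp [Real.pi_pos.le]
    left
    ring
  have hBint : ∫ p in Ioi (0 : ℝ) ×ˢ Ioo (-Real.pi) Real.pi, B p = 0 := by
    rw [Measure.volume_eq_prod, setIntegral_prod _ hBi]
    refine setIntegral_eq_zero_of_forall_eq_zero fun r hr => ?_
    have hd : ∀ t : ℝ, HasDerivAt (fun t : ℝ => u (z + r * e t)) (r * B (r, t)) t := by
      intro t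
      have h2 : HasDerivAt (fun t : ℝ => z + r * e t) (r * (Complex.I * e t)) t := by
        have h3 : HasDerivAt e (e t * Complex.I) t := by
          simpa using ((Complex.ofRealCLM.hasDerivAt (x := t)).mul_const Complex.I).cexp
        simpa [mul_comm] using (h3.const_mul (r : ℂ)).const_add z
      have h4 := (hud _).hasFDerivAt.comp_hasDerivAt t h2
      have h5 : (r : ℂ) * (Complex.I * e t) = r • (Complex.I * e t) := by simp
      rw [h5, map_smul, Complex.real_smul] at h4
      exact h4
    have h6 : ∫ t in (-Real.pi)..Real.pi, (r * B (r, t) : ℂ) = 0 := by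
      rw [intervalIntegral.integral_eq_sub_of_hasDerivAt (fun t _ => hd t)
        (Continuous.intervalIntegrable (continuous_const.mul (hBc.comp (by fun_prop))) _ _)]
      simp [e, Complex.exp_neg]
    rw [intervalIntegral.integral_const_mul, intervalIntegral.integral_of_le
      (by linarith [Real.pi_pos]), integral_Ioc_eq_integral_Ioo] at h6
    have hr' : (r : ℂ) ≠ 0 := by exact_mod_cast (ne_of_gt hr)
    exact (mul_eq_zero.1 h6).resolve_left hr'
  rw [← Complex.integral_comp_polarCoord_symm, hpol]
  have hcongr : ∫ p in Ioi (0 : ℝ) ×ˢ Ioo (-Real.pi) Real.pi,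
      p.1 • ((Complex.polarCoord.symm p)⁻¹ * dbar u (z + Complex.polarCoord.symm p)) =
      ∫ p in Ioi (0 : ℝ) ×ˢ Ioo (-Real.pi) Real.pi, (A p + Complex.I * B p) := by
    refine setIntegral_congr_fun (measurableSet_Ioi.prod measurableSet_Ioo) fun p hp => ?_
    have hp1 : (p.1 : ℂ) ≠ 0 := by exact_mod_cast (ne_of_gt hp.1)
    have h7 : Complex.polarCoord.symm p = p.1 * e p.2 := by
      rw [Complex.polarCoord_symm_apply]
      simp [e, Complex.exp_mul_I]
    simp only [h7, A, B]
    rw [← dbar_polar, Complex.real_smul, mul_inv, ← mul_assoc, ← mul_assoc,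
      mul_inv_cancel₀ hp1, one_mul]
  rw [hcongr, Measure.volume_eq_prod, integral_add hAi (hBi.const_mul _), integral_const_mul,
    ← Measure.volume_eq_prod, hAint, hBint]
  simp

/-! ### Runge's theorem in closed subalgebras of `C(X, ℂ)` -/

theorem exists_cutoff {X U : Set ℂ} (hX : IsCompact X) (hU : IsOpen U) (hXU : X ⊆ U) :
    ∃ χ : ℂ → ℝ, ContDiff ℝ 1 χ ∧ HasCompactSupport χ ∧ tsupport χ ⊆ U ∧
      ∀ᶠ w in 𝓝ˢ X, χ w = 1 := by
  obtain ⟨K, hK, hXK, hKU⟩ := exists_compact_between hX hU hXU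
  obtain ⟨χ, h1, h0, -⟩ := exists_contMDiffMap_one_nhds_of_subset_interior
    (modelWithCornersSelf ℝ ℂ) (n := 1) hX.isClosed hXK
  have hs : tsupport χ ⊆ K :=
    closure_minimal (fun x hx => by_contra fun h => hx (h0 x h)) hK.isClosed
  exact ⟨χ, χ.contMDiff.contDiff, hK.of_isClosed_subset (isClosed_tsupport _) hs,
    hs.trans hKU, h1⟩

theorem contDiff_cutoff_mul {U : Set ℂ} (hU : IsOpen U) {χ : ℂ → ℝ} (hχ : ContDiff ℝ 1 χ)
    (hs : tsupport χ ⊆ U) {F : ℂ → ℂ} (hF : DifferentiableOn ℂ F U) :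
    ContDiff ℝ 1 (fun w => (χ w : ℂ) * F w) := by
  refine contDiff_iff_contDiffAt.2 fun w => ?_
  by_cases hw : w ∈ U
  · have h1 : ContDiffAt ℝ 1 F w :=
      ((hF.analyticAt (hU.mem_nhds hw)).contDiffAt (n := 1)).restrict_scalars ℝ
    exact (Complex.ofRealCLM.contDiff.comp hχ).contDiffAt.mul h1
  · have h0 : χ =ᶠ[𝓝 w] 0 := notMem_tsupport_iff_eventuallyEq.1 fun h => hw (hs h)
    refine (contDiffAt_const (c := (0 : ℂ))).congr_of_eventuallyEq ?_
    filter_upwards [h0] with x hx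
    simp [hx]

open MeasureTheory in
-- The continuous quotient map by `A` commutes with the integral and kills the integrand.
theorem integral_mem_of_isClosed {Y : Type*} [TopologicalSpace Y] [CompactSpace Y]
    (A : Submodule ℂ C(Y, ℂ)) (hA : IsClosed (A : Set C(Y, ℂ))) (Φ : ℂ → C(Y, ℂ))
    (hi : Integrable Φ) (hm : ∀ w, Φ w ∈ A) : ∫ w, Φ w ∈ A := by
  have : IsClosed (A : Set C(Y, ℂ)) := hA
  have h1 : A.mkQL (∫ w, Φ w) = ∫ w, A.mkQL (Φ w) := (A.mkQL.integral_comp_comm hi).symm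
  have h2 : ∀ w, A.mkQL (Φ w) = 0 := fun w => (Submodule.Quotient.mk_eq_zero A).2 (hm w)
  simp only [h2, integral_zero] at h1
  exact (Submodule.Quotient.mk_eq_zero A).1 h1

open MeasureTheory in
/-- A closed subalgebra of `C(X, ℂ)` that contains all the functions `z ↦ (z - a)⁻¹`, `a ∉ X`,
contains all functions holomorphic near `X`. -/
theorem mem_of_differentiableOn {X U : Set ℂ} [CompactSpace X] (hU : IsOpen U) (hXU : X ⊆ U)
    {F : ℂ → ℂ} (hF : DifferentiableOn ℂ F U) (A : Subalgebra ℂ C(X, ℂ))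
    (hA : IsClosed (A : Set C(X, ℂ)))
    (hinv : ∀ a ∉ X, ∃ g ∈ A, ∀ z : X, ((z : ℂ) - a) * g z = 1)
    (φ : C(X, ℂ)) (hφ : ∀ z : X, φ z = F z) : φ ∈ A := by
  have hX : IsCompact X := isCompact_iff_compactSpace.2 inferInstance
  obtain ⟨χ, hχ, hχc, hχU, hχ1⟩ := exists_cutoff hX hU hXU
  set u : ℂ → ℂ := fun w => (χ w : ℂ) * F w with hu
  have huc : ContDiff ℝ 1 u := contDiff_cutoff_mul hU hχ hχU hF
  have hucs : HasCompactSupport u :=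
    (hχc.comp_left (g := fun x : ℝ => (x : ℂ)) (by simp)).mul_right
  have hG : Continuous (dbar u) := continuous_dbar huc
  have hGs : HasCompactSupport (dbar u) :=
    (hucs.fderiv ℝ).comp_left (g := fun L : ℂ →L[ℝ] ℂ => L 1 + Complex.I * L Complex.I) (by simp)
  have hG0 : ∀ᶠ w in 𝓝ˢ X, dbar u w = 0 := by
    obtain ⟨V, hV, hXV, hV1⟩ := eventually_nhdsSet_iff_exists.1 hχ1
    filter_upwards [hV.mem_nhdsSet.2 hXV, hU.mem_nhdsSet.2 hXU] with w hw hwU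
    rw [dbar_congr (v := F)]
    · exact dbar_eq_zero_of_differentiableAt (hF.differentiableAt (hU.mem_nhds hwU))
    · filter_upwards [hV.mem_nhds hw] with x hx
      simp [hu, hV1 x hx]
  let ψ : ℂ × X → ℂ := fun p => (p.1 - p.2)⁻¹ * dbar u p.1
  -- The singularity `w = z` is harmless because `dbar u` vanishes near `X`.
  have hψ : Continuous ψ := by
    refine continuous_iff_continuousAt.2 fun ⟨w, z⟩ => ?_
    by_cases hwz : w = z
    · have h1 : ∀ᶠ x in 𝓝 w, dbar u x = 0 :=
        eventually_nhdsSet_iff_forall.1 hG0 w (hwz ▸ z.2)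
      have h2 : ψ =ᶠ[𝓝 (w, z)] fun _ => 0 := by
        filter_upwards [continuousAt_fst.eventually h1] with p hp
        have hp' : dbar u p.1 = 0 := hp
        simp [ψ, hp']
      exact continuousAt_const.congr h2.symm
    · refine ContinuousAt.mul (ContinuousAt.inv₀ (by fun_prop) (sub_ne_zero.2 hwz)) ?_
      exact hG.continuousAt.comp continuousAt_fst
  let Φ : C(ℂ, C(X, ℂ)) := ContinuousMap.curry ⟨ψ, hψ⟩
  have hΦ : ∀ w (z : X), Φ w z = (w - z)⁻¹ * dbar u w := fun _ _ => rfl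
  have hΦs : HasCompactSupport Φ := by
    refine hGs.mono' (subset_closure.trans' fun w hw => ?_)
    rw [Function.mem_support] at hw ⊢
    contrapose! hw
    ext z
    simp [hΦ, hw]
  have hΦi : Integrable Φ := Φ.continuous.integrable_of_hasCompactSupport hΦs
  have hΦA : ∀ w, Φ w ∈ A := by
    intro w
    by_cases hw : w ∈ X
    · convert A.zero_mem
      ext z
      simp [hΦ, eventually_nhdsSet_iff_forall.1 hG0 w hw |>.self_of_nhds]
    · obtain ⟨g, hg, hgz⟩ := hinv w hw
      convert A.smul_mem hg (-dbar u w)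
      ext z
      have h0 : (w : ℂ) - z ≠ 0 := sub_ne_zero.2 fun h => hw (h ▸ z.2)
      have h1 : g z = -(w - z)⁻¹ := by
        rw [← neg_sub, inv_neg, neg_neg]
        have := hgz z
        have h0' : (z : ℂ) - w ≠ 0 := sub_ne_zero.2 fun h => hw (h ▸ z.2)
        field_simp
        linear_combination this
      rw [hΦ, ContinuousMap.smul_apply, h1, smul_eq_mul]
      ring
  have hI : ∫ w, Φ w ∈ A :=
    integral_mem_of_isClosed A.toSubmodule hA Φ hΦi hΦA
  have hval : ∀ z : X, (∫ w, Φ w) z = -(2 * Real.pi) * φ z := by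
    intro z
    have h1 : (∫ w, Φ w) z = ∫ w, Φ w z :=
      ((ContinuousMap.evalCLM ℂ z).integral_comp_comm hΦi).symm
    have h2 := integral_inv_mul_dbar huc hucs z
    have h3 := integral_add_left_eq_self (μ := volume) (fun w => Φ w z) (z : ℂ)
    simp only [hΦ, add_sub_cancel_left] at h3
    rw [h1]
    simp only [hΦ]
    rw [← h3, h2, hφ]
    have : χ z = 1 := hχ1.self_of_nhdsSet z z.2
    simp [hu, this]
  convert A.smul_mem hI (-(2 * Real.pi : ℂ)⁻¹)
  ext z
  rw [ContinuousMap.smul_apply, hval, smul_eq_mul]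
  have : (Real.pi : ℂ) ≠ 0 := by exact_mod_cast Real.pi_ne_zero
  field_simp

/-- The coordinate function. -/
def coord (X : Set ℂ) : C(X, ℂ) := ⟨fun z => z, continuous_subtype_val⟩

/-- If sufficiently many logarithms exist on `X`, then the spectrum of the coordinate
function in a closed subalgebra `A` of `C(X, ℂ)` is contained in `X`. -/
theorem exists_inv_of_hasLogOn {X : Set ℂ} [CompactSpace X] (A : Subalgebra ℂ C(X, ℂ))
    (hA : IsClosed (A : Set C(X, ℂ))) (hx : coord X ∈ A)
    (hlog : ∀ a ∉ X, HasLogOn X (fun z => z - a) ∨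
      ∃ b, (∃ g ∈ A, ∀ z : X, ((z : ℂ) - b) * g z = 1) ∧
        HasLogOn X (fun z => (z - a) / (z - b))) :
    ∀ a ∉ X, ∃ g ∈ A, ∀ z : X, ((z : ℂ) - a) * g z = 1 := by
  have hX : IsClosed X := (isCompact_iff_compactSpace.2 inferInstance).isClosed
  have : IsClosed (A : Set C(X, ℂ)) := hA
  have : CompleteSpace A := hA.completeSpace_coe
  let x : A := ⟨coord X, hx⟩
  have hspec : ∀ a, a ∉ spectrum ℂ x ↔ ∃ g ∈ A, ∀ z : X, ((z : ℂ) - a) * g z = 1 := by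
    intro a
    rw [spectrum.notMem_iff]
    constructor
    · rintro hu
      obtain ⟨g, hg⟩ := hu.exists_right_inv
      refine ⟨-g, A.neg_mem g.2, fun z => ?_⟩
      have h1 := congr(($hg : C(X, ℂ)) z)
      have h2 : (a - (z : ℂ)) * (g : C(X, ℂ)) z = 1 := h1
      rw [ContinuousMap.neg_apply]
      linear_combination h2
    · rintro ⟨g, hg, h⟩
      refine IsUnit.of_mul_eq_one (⟨-g, A.neg_mem hg⟩ : A) ?_
      ext z
      change (a - (z : ℂ)) * (-g z) = 1
      linear_combination h z
  -- Passing to a closed subalgebra can only fill holes of the spectrum: its frontier stays in the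
  -- spectrum taken in `C(X, ℂ)`, which is `X`.
  have hfr : frontier (spectrum ℂ x) ⊆ X := by
    refine (Subalgebra.frontier_spectrum A x).trans ?_
    rw [ContinuousMap.spectrum_eq_range]
    rintro _ ⟨z, rfl⟩
    exact z.2
  have hsc : IsClosed (spectrum ℂ x) := spectrum.isClosed x
  set B : Set ℂ := interior (spectrum ℂ x) \ X with hB
  have hBo : IsOpen B := isOpen_interior.sdiff hX
  have hBeq : ∀ a ∈ spectrum ℂ x, a ∉ X → a ∈ B := fun a ha haX =>
    ⟨by_contra fun h => haX (hfr ⟨subset_closure ha, h⟩), haX⟩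
  have hBb : Bornology.IsBounded B :=
    (spectrum.isCompact x).isBounded.subset (sdiff_subset.trans interior_subset)
  have hBfr : frontier B ⊆ X := by
    intro z hz
    by_contra hzX
    have h1 : z ∈ spectrum ℂ x :=
      closure_minimal (sdiff_subset.trans interior_subset) hsc hz.1
    rw [hBo.frontier_eq] at hz
    exact hz.2 (hBeq z h1 hzX)
  intro a haX
  rw [← hspec]
  intro ha
  have haB := hBeq a ha haX
  rcases hlog a haX with h | ⟨b, hb, h⟩
  · exact not_hasLogOn_of_frontier_subset hX hBb hBfr haB (q := fun _ => 1) continuous_const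
      (by simp) (by simp) (by simpa using h)
  · refine not_hasLogOn_of_frontier_subset hX hBb hBfr haB (q := fun z => z - b) (by fun_prop)
      (fun z hz h0 => ?_) (fun z hz h0 => ?_) h
    · rw [sub_eq_zero] at h0
      exact (hspec b).2 hb (h0 ▸ interior_subset hz.1)
    · obtain ⟨g, -, hg⟩ := hb
      have := hg ⟨z, hz⟩
      simp [h0] at this

/-! ### Logarithms on large compact subsets -/

/-- The points of `closedBall 0 R` at distance at least `δ` from the complement of `D`. -/
def core (D : Set ℂ) (R δ : ℝ) : Set ℂ :=
  {z | ‖z‖ ≤ R ∧ ∀ b ∉ D, δ ≤ ‖z - b‖}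

theorem isCompact_core (D : Set ℂ) (R δ : ℝ) : IsCompact (core D R δ) := by
  refine (isCompact_closedBall (0 : ℂ) R).of_isClosed_subset ?_ fun z hz => by simpa using hz.1
  have : core D R δ = {z : ℂ | ‖z‖ ≤ R} ∩ ⋂ b, ⋂ (_ : b ∉ D), {z | δ ≤ ‖z - b‖} := by
    ext z
    simp [core]
  rw [this]
  exact (isClosed_le (by fun_prop) (by fun_prop)).inter
    (isClosed_iInter fun b => isClosed_iInter fun _ => isClosed_le (by fun_prop) (by fun_prop))

theorem core_subset (D : Set ℂ) (R : ℝ) {δ : ℝ} (hδ : 0 < δ) : core D R δ ⊆ D := by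
  intro z hz
  by_contra h
  have := hz.2 z h
  simp only [sub_self, norm_zero] at this
  exact absurd hδ this.not_gt

theorem exists_subset_core {D K : Set ℂ} (hD : IsOpen D) (hK : IsCompact K) (hKD : K ⊆ D) :
    ∃ R δ : ℝ, 0 < δ ∧ K ⊆ core D R δ := by
  obtain ⟨δ, hδ, h⟩ := hK.exists_thickening_subset_open hD hKD
  obtain ⟨R, hR⟩ := hK.isBounded.subset_closedBall 0
  refine ⟨R, δ, hδ, fun z hz => ⟨by simpa using hR hz, fun b hb => ?_⟩⟩
  by_contra! hlt
  exact hb (h (Metric.mem_thickening_iff.2 ⟨z, hz, by rwa [dist_comm, dist_eq_norm]⟩))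

/-- This dichotomy is the reason for using cores: either alternative lets `z - a` be compared with a
constant or with `z - b`. -/
theorem norm_lt_or_exists_of_notMem_core {D : Set ℂ} {R δ : ℝ} {a : ℂ} (ha : a ∉ core D R δ) :
    (∀ z ∈ core D R δ, ‖z‖ < ‖a‖) ∨
      ∃ b ∉ D, ∀ z ∈ core D R δ, ‖a - b‖ < ‖z - b‖ := by
  by_cases h : ‖a‖ ≤ R
  · right
    have : ¬ ∀ b ∉ D, δ ≤ ‖a - b‖ := fun h' => ha ⟨h, h'⟩
    push Not at this
    obtain ⟨b, hb, hab⟩ := this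
    exact ⟨b, hb, fun z hz => hab.trans_le (hz.2 b hb)⟩
  · exact Or.inl fun z hz => hz.1.trans_lt (not_le.1 h)

/-- For a compact set `L` the points `b ∉ L` such that `z - b` has a logarithm on `L` form,
together with `∞`, an open and closed subset of the complement of `L`. -/
theorem hasLogOn_sub_of_isPreconnected {L : Set ℂ} (hL : IsCompact L) {C : Set (OnePoint ℂ)}
    (hC : IsPreconnected C) (hCL : ∀ z ∈ L, (z : OnePoint ℂ) ∉ C) (hinf : OnePoint.infty ∈ C)
    {b : ℂ} (hb : (b : OnePoint ℂ) ∈ C) : HasLogOn L (fun z => z - b) := by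
  by_contra hcon
  have hnear : ∀ a ∉ L, ∀ᶠ a' in 𝓝 a, a' ∉ L ∧
      ∀ z ∈ L, ‖a' - a‖ < ‖z - a‖ ∧ ‖a - a'‖ < ‖z - a'‖ := by
    intro a ha
    obtain ⟨ε, hε, h⟩ := Metric.isOpen_iff.1 hL.isClosed.isOpen_compl a ha
    filter_upwards [hL.isClosed.isOpen_compl.mem_nhds ha,
      -- Half the radius makes the comparison of `a` and `a'` work in both directions.
      Metric.ball_mem_nhds a (half_pos hε)] with a' h1 h2
    refine ⟨h1, fun z hz => ?_⟩
    have h3 : ε ≤ ‖z - a‖ := by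
      by_contra! hlt
      exact h (mem_ball_iff_norm.2 hlt) hz
    have h2' : ‖a' - a‖ < ε / 2 := mem_ball_iff_norm.1 h2
    have h4 : ‖z - a‖ ≤ ‖z - a'‖ + ‖a' - a‖ := norm_sub_le_norm_sub_add_norm_sub _ _ _
    rw [norm_sub_rev a a']
    constructor <;> linarith
  set S : Set ℂ := {a | a ∉ L ∧ HasLogOn L (fun z => z - a)} with hS
  set T : Set ℂ := {a | a ∉ L ∧ ¬ HasLogOn L (fun z => z - a)} with hT
  have hSo : IsOpen S := by
    refine isOpen_iff_eventually.2 fun a ha => ?_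
    filter_upwards [hnear a ha.1] with a' h
    exact ⟨h.1, ha.2.sub_of_sub fun z hz => (h.2 z hz).1⟩
  have hTo : IsOpen T := by
    refine isOpen_iff_eventually.2 fun a ha => ?_
    filter_upwards [hnear a ha.1] with a' h
    exact ⟨h.1, fun h' => ha.2 (h'.sub_of_sub fun z hz => (h.2 z hz).2)⟩
  set S' : Set (OnePoint ℂ) := insert OnePoint.infty (toSphere S) with hS'
  set T' : Set (OnePoint ℂ) := toSphere T with hT'
  have hS'o : IsOpen S' := by
    rw [OnePoint.isOpen_iff_of_mem (mem_insert _ _)]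
    have hpre : (OnePoint.some ⁻¹' S' : Set ℂ) = S := by
      ext z
      simp [hS', toSphere]
    rw [hpre]
    obtain ⟨R, hR⟩ := hL.isBounded.subset_closedBall 0
    have hsub : Sᶜ ⊆ Metric.closedBall 0 R := by
      intro a ha
      by_contra hlt
      have hlt' : R < ‖a‖ := by simpa using hlt
      exact ha ⟨fun haL => hlt (hR haL), HasLogOn.sub_of_norm_lt fun z hz =>
        lt_of_le_of_lt (by simpa using hR hz) hlt'⟩
    exact ⟨hSo.isClosed_compl,
      (isCompact_closedBall 0 R).of_isClosed_subset hSo.isClosed_compl hsub⟩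
  have hT'o : IsOpen T' := OnePoint.isOpen_image_coe.2 hTo
  have hbT : (b : OnePoint ℂ) ∈ T' := ⟨b, ⟨fun h => hCL b h hb, hcon⟩, rfl⟩
  have hcov : C ⊆ S' ∪ T' := by
    intro x hx
    induction x using OnePoint.rec with
    | infty => exact Or.inl (mem_insert _ _)
    | coe a =>
      by_cases h : HasLogOn L (fun z => z - a)
      · exact Or.inl (mem_insert_of_mem _ ⟨a, ⟨fun h => hCL a h hx, h⟩, rfl⟩)
      · exact Or.inr ⟨a, ⟨fun h => hCL a h hx, h⟩, rfl⟩
  obtain ⟨x, -, hx1, hx2⟩ := hC S' T' hS'o hT'o hcov ⟨_, hinf, mem_insert _ _⟩ ⟨_, hb, hbT⟩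
  obtain ⟨a, ha, rfl⟩ := hx2
  rcases hx1 with h | ⟨a', ha', h⟩
  · exact OnePoint.coe_ne_infty _ h
  · exact ha.2 (OnePoint.coe_injective h ▸ ha'.2)

/-- If `a` is close to some `b ∉ D`, the component of `b` in the complement of `D` avoids the core
and reaches `∞`. This gives a logarithm of `z - b`, and then of `z - a`. -/
theorem hasLogOn_core_sub {D : Set ℂ} (hD : HasNoHoles D) {R δ : ℝ} (hδ : 0 < δ) {a : ℂ}
    (ha : a ∉ core D R δ) : HasLogOn (core D R δ) (fun z => z - a) := by
  rcases norm_lt_or_exists_of_notMem_core ha with h | ⟨b, hb, h⟩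
  · exact HasLogOn.sub_of_norm_lt h
  refine HasLogOn.sub_of_sub ?_ h
  have hbD : (b : OnePoint ℂ) ∈ (toSphere D)ᶜ := by
    rintro ⟨d, hd, h⟩
    exact hb (OnePoint.coe_injective h ▸ hd)
  refine hasLogOn_sub_of_isPreconnected (isCompact_core D R δ)
    (isPreconnected_connectedComponentIn (F := (toSphere D)ᶜ) (x := (b : OnePoint ℂ)))
    (fun z hz hzC => connectedComponentIn_subset _ _ hzC ⟨z, core_subset D R hδ hz, rfl⟩) ?_
    (mem_connectedComponentIn hbD)
  by_contra hinf
  exact hD _ ⟨⟨_, hbD, rfl⟩, hinf⟩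

/-- Polynomials without zeros on `S` have logarithms if all linear ones do. -/
theorem hasLogOn_polynomial {S : Set ℂ} (hS : ∀ a ∉ S, HasLogOn S (fun z => z - a))
    (p : Polynomial ℂ) (hp0 : p ≠ 0) (hp : ∀ z ∈ S, p.eval z ≠ 0) :
    HasLogOn S (fun z => p.eval z) := by
  have hroots : ∀ a ∈ p.roots, a ∉ S := fun a ha haS =>
    hp a haS ((Polynomial.mem_roots hp0).1 ha)
  have key : ∀ s : Multiset ℂ, (∀ a ∈ s, a ∉ S) →
      HasLogOn S (fun z => (s.map fun a => z - a).prod) := by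
    intro s
    induction s using Multiset.induction with
    | empty => exact fun _ => (HasLogOn.const one_ne_zero).congr (by simp)
    | cons a s ih =>
      intro h
      have h1 := (hS a (h a (by simp))).mul (ih fun b hb => h b (by simp [hb]))
      exact h1.congr (by simp)
  refine ((HasLogOn.const (Polynomial.leadingCoeff_ne_zero.2 hp0)).mul
    (key p.roots hroots)).congr fun z _ => ?_
  conv_rhs => rw [(IsAlgClosed.splits p).eq_prod_roots]
  simp [Polynomial.eval_multiset_prod]

/-- If all functions `z - a`, `a ∉ L`, have logarithms on the compact set `L`, then so do
all functions holomorphic near `L` and without zeros on `L`. -/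
theorem hasLogOn_of_differentiableOn {L U : Set ℂ} (hL : IsCompact L) (hU : IsOpen U)
    (hLU : L ⊆ U) (hlog : ∀ a ∉ L, HasLogOn L (fun z => z - a)) {F : ℂ → ℂ}
    (hF : DifferentiableOn ℂ F U) (hF0 : ∀ z ∈ L, F z ≠ 0) : HasLogOn L F := by
  rcases L.eq_empty_or_nonempty with rfl | hne
  · exact ⟨0, by simp, by simp⟩
  have hFc : ContinuousOn F L := hF.continuousOn.mono hLU
  have : CompactSpace L := isCompact_iff_compactSpace.1 hL
  let A : Subalgebra ℂ C(L, ℂ) := (polynomialFunctions L).topologicalClosure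
  have hA : IsClosed (A : Set C(L, ℂ)) := Subalgebra.isClosed_topologicalClosure _
  have hpA : ∀ p : Polynomial ℂ, p.toContinuousMapOn L ∈ A := fun p =>
    Subalgebra.le_topologicalClosure _ ⟨p, trivial, rfl⟩
  have hx : coord L ∈ A := by
    convert hpA Polynomial.X
    ext z
    simp [coord]
  have hinv := exists_inv_of_hasLogOn A hA hx fun a ha => Or.inl (hlog a ha)
  have hmem := mem_of_differentiableOn hU hLU hF A hA hinv
    ⟨L.domRestrict F, continuousOn_iff_continuous_domRestrict.1 hFc⟩ fun _ => rfl
  obtain ⟨w, hw, hmin⟩ := hL.exists_isMinOn hne hFc.norm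
  have hpos : 0 < ‖F w‖ := norm_pos_iff.2 (hF0 w hw)
  -- An error below half the minimum of `‖F‖` leaves the polynomial zero-free on `L` and close
  -- enough to `F` to transfer its logarithm.
  obtain ⟨g, hg, hgd⟩ := Metric.mem_closure_iff.1 hmem _ (half_pos hpos)
  obtain ⟨p, -, rfl⟩ := hg
  have hlt : ∀ z ∈ L, ‖F z - p.eval z‖ < ‖p.eval z‖ := by
    intro z hz
    have h1 : ‖F z - p.eval z‖ < ‖F w‖ / 2 := by
      rw [← dist_eq_norm]
      exact (ContinuousMap.dist_lt_iff (half_pos hpos)).1 hgd ⟨z, hz⟩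
    have h2 : ‖F w‖ ≤ ‖F z‖ := hmin hz
    have h3 := norm_sub_norm_le (F z) (p.eval z)
    linarith
  have hp : ∀ z ∈ L, p.eval z ≠ 0 := fun z hz =>
    norm_pos_iff.1 ((norm_nonneg _).trans_lt (hlt z hz))
  have hp0 : p ≠ 0 := by
    rintro rfl
    exact hp w hw (by simp)
  exact (hasLogOn_polynomial hlog p hp0 hp).of_norm_sub_lt p.continuous.continuousOn hFc hlt

/-! ### Inverses of injective holomorphic functions -/

theorem nhds_le_map_of_injOn {D : Set ℂ} (hD : IsOpen D) {E : ℂ → ℂ}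
    (hE : DifferentiableOn ℂ E D) (hinj : InjOn E D) {w : ℂ} (hw : w ∈ D) :
    𝓝 (E w) ≤ map E (𝓝 w) := by
  have hDw := hD.mem_nhds hw
  refine (hE.analyticAt hDw).eventually_constant_or_nhds_le_map_nhds_aux.resolve_left fun h => ?_
  have h1 : ∀ᶠ z in 𝓝[≠] w, False := by
    filter_upwards [nhdsWithin_le_nhds (h.and hDw), self_mem_nhdsWithin] with z hz hne
    exact hne (hinj hz.2 hw hz.1)
  exact (NormedField.nhdsNE_neBot w).ne (by simpa using h1)

theorem eventually_deriv_ne_zero_of_injOn {D : Set ℂ} (hD : IsOpen D) {E : ℂ → ℂ}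
    (hE : DifferentiableOn ℂ E D) (hinj : InjOn E D) {w : ℂ} (hw : w ∈ D) :
    ∀ᶠ z in 𝓝[≠] w, deriv E z ≠ 0 := by
  have hDw := hD.mem_nhds hw
  refine (hE.analyticAt hDw).deriv.eventually_eq_zero_or_eventually_ne_zero.resolve_left
    fun h => ?_
  obtain ⟨ε, hε, hb⟩ := Metric.eventually_nhds_iff_ball.1 (h.and hDw)
  have hconst : ∀ z ∈ Metric.ball w ε, E z = E w := by
    intro z hz
    refine (convex_ball w ε).is_const_of_fderivWithin_eq_zero (𝕜 := ℂ)
      (hE.mono fun y hy => (hb y hy).2) (fun y hy => ?_) hz (Metric.mem_ball_self hε)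
    rw [fderivWithin_of_isOpen Metric.isOpen_ball hy]
    ext
    simp [(hb y hy).1]
  have h1 : ∀ᶠ z in 𝓝[≠] w, False := by
    filter_upwards [nhdsWithin_le_nhds (Metric.ball_mem_nhds w hε), self_mem_nhdsWithin]
      with z hz hne
    exact hne (hinj (hb z hz).2 hw (hconst z hz))
  exact (NormedField.nhdsNE_neBot w).ne (by simpa using h1)

/-- Openness of `E` makes the inverse continuous. It is differentiable where `deriv E ≠ 0`; possible
zeros of `deriv E` are isolated, and the singularities there are removable. -/
theorem exists_holomorphic_inverse {D : Set ℂ} (hD : IsOpen D) {E : ℂ → ℂ}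
    (hE : DifferentiableOn ℂ E D) (hinj : InjOn E D) :
    IsOpen (E '' D) ∧ ∃ φ : ℂ → ℂ, DifferentiableOn ℂ φ (E '' D) ∧ ∀ w ∈ D, φ (E w) = w := by
  have hopen : IsOpen (E '' D) := by
    refine isOpen_iff_mem_nhds.2 ?_
    rintro _ ⟨w, hw, rfl⟩
    exact nhds_le_map_of_injOn hD hE hinj hw (image_mem_map (hD.mem_nhds hw))
  have hφ : ∀ w ∈ D, Function.invFunOn E D (E w) = w := fun w hw => hinj.leftInvOn_invFunOn hw
  set φ := Function.invFunOn E D with hφdef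
  have hcont : ∀ w ∈ D, ContinuousAt φ (E w) := by
    intro w hw V hV
    rw [hφ w hw] at hV
    have h1 := nhds_le_map_of_injOn hD hE hinj hw
      (image_mem_map (inter_mem hV (hD.mem_nhds hw)))
    refine mem_map.2 (mem_of_superset h1 ?_)
    rintro _ ⟨z, ⟨hzV, hzD⟩, rfl⟩
    rwa [mem_preimage, hφ z hzD]
  have hright : ∀ y ∈ E '' D, E (φ y) = y := by
    rintro _ ⟨w, hw, rfl⟩
    rw [hφ w hw]
  have hreg : ∀ w ∈ D, deriv E w ≠ 0 → DifferentiableAt ℂ φ (E w) := by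
    intro w hw hd
    have h1 : HasDerivAt E (deriv E w) (φ (E w)) := by
      rw [hφ w hw]
      exact (hE.differentiableAt (hD.mem_nhds hw)).hasDerivAt
    refine (HasDerivAt.of_local_left_inverse (hcont w hw) h1 hd ?_).differentiableAt
    filter_upwards [hopen.mem_nhds (mem_image_of_mem E hw)] with y hy using hright y hy
  refine ⟨hopen, φ, ?_, hφ⟩
  rintro _ ⟨w, hw, rfl⟩
  refine (Complex.analyticAt_of_differentiable_on_punctured_nhds_of_continuousAt ?_
    (hcont w hw)).differentiableAt.differentiableWithinAt
  have h1 : Tendsto φ (𝓝[≠] (E w)) (𝓝[≠] w) := by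
    refine tendsto_nhdsWithin_iff.2 ⟨?_, ?_⟩
    · have := (hcont w hw).tendsto
      rw [hφ w hw] at this
      exact this.mono_left nhdsWithin_le_nhds
    · filter_upwards [nhdsWithin_le_nhds (hopen.mem_nhds (mem_image_of_mem E hw)),
        self_mem_nhdsWithin] with y hy hne h
      exact hne (by rw [← hright y hy, h]; rfl)
  filter_upwards [h1.eventually (eventually_deriv_ne_zero_of_injOn hD hE hinj hw),
    nhdsWithin_le_nhds (hopen.mem_nhds (mem_image_of_mem E hw))] with y hy hyD
  obtain ⟨z, hz, rfl⟩ := hyD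
  rw [hφ z hz] at hy
  exact hreg z hz hy

/-! ### Distance to the boundary in the extended plane -/

theorem chordal_coe_coe (z w : ℂ) : chordal (z : OnePoint ℂ) (w : OnePoint ℂ) =
    2 * ‖z - w‖ / (√(1 + ‖z‖ ^ 2) * √(1 + ‖w‖ ^ 2)) := rfl

theorem chordal_coe_infty (z : ℂ) : chordal (z : OnePoint ℂ) OnePoint.infty =
    2 / √(1 + ‖z‖ ^ 2) := rfl

theorem sqrt_one_add_sq_le {x : ℝ} (hx : 0 ≤ x) : √(1 + x ^ 2) ≤ 1 + x := by
  rw [Real.sqrt_le_left (by linarith)]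
  nlinarith

/-- Needed because `sInf ∅ = 0` would make `chordalDist` to an empty boundary vanish. The sphere is
connected and `∞` is not in `toSphere Ω`. -/
theorem nonempty_sphereBoundary {Ω : Set ℂ} (hΩ : Ω.Nonempty) : (sphereBoundary Ω).Nonempty := by
  refine nonempty_frontier_iff.2 ⟨hΩ.image _, fun h => ?_⟩
  obtain ⟨z, -, hz⟩ := (h ▸ mem_univ OnePoint.infty : OnePoint.infty ∈ toSphere Ω)
  exact OnePoint.coe_ne_infty z hz

theorem exists_pos_le_chordalDist {Ω K : Set ℂ} (hΩ : IsOpen Ω) (hne : Ω.Nonempty)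
    (hK : IsCompact K) (hKΩ : K ⊆ Ω) :
    ∃ c > 0, ∀ w ∈ K, c ≤ chordalDist (w : OnePoint ℂ) (sphereBoundary Ω) := by
  obtain ⟨R₀, δ, hδ, hsub⟩ := exists_subset_core hΩ hK hKΩ
  set R := max R₀ 0
  have hR : 0 ≤ R := le_max_right _ _
  have hfr : Disjoint (sphereBoundary Ω) (toSphere Ω) := by
    have ho : IsOpen (toSphere Ω) := OnePoint.isOpen_image_coe.2 hΩ
    rw [sphereBoundary, ho.frontier_eq]
    exact disjoint_sdiff_left
  -- The two terms bound the distance to `∞` and to finite boundary points; the second uses that `t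
  -- / (1 + R + t)` increases in `t = ‖w - b‖ ≥ δ`.
  refine ⟨min (2 / (1 + R)) (2 * δ / ((1 + R) * (1 + R + δ))), by positivity, fun w hw => ?_⟩
  have hwR : ‖w‖ ≤ R := (hsub hw).1.trans (le_max_left _ _)
  have hs1 : √(1 + ‖w‖ ^ 2) ≤ 1 + R := (sqrt_one_add_sq_le (norm_nonneg _)).trans (by linarith)
  refine le_csInf ((nonempty_sphereBoundary hne).image _) ?_
  rintro _ ⟨x, hx, rfl⟩
  induction x using OnePoint.rec with
  | infty =>
    refine (min_le_left _ _).trans ?_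
    rw [chordal_coe_infty]
    gcongr
  | coe b =>
    refine (min_le_right _ _).trans ?_
    have hb : b ∉ Ω := fun h => hfr.le_bot ⟨hx, ⟨b, h, rfl⟩⟩
    have hδb : δ ≤ ‖w - b‖ := (hsub hw).2 b hb
    have h1 : ‖b‖ ≤ ‖w‖ + ‖w - b‖ := by
      have := norm_sub_norm_le b w
      rw [norm_sub_rev b w] at this
      linarith
    have hs2 : √(1 + ‖b‖ ^ 2) ≤ 1 + R + ‖w - b‖ :=
      (sqrt_one_add_sq_le (norm_nonneg _)).trans (by linarith)
    rw [chordal_coe_coe]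
    have h2 : 2 * δ / ((1 + R) * (1 + R + δ)) ≤
        2 * ‖w - b‖ / ((1 + R) * (1 + R + ‖w - b‖)) := by
      rw [div_le_div_iff₀ (by positivity) (by positivity)]
      have : 0 ≤ 2 * (1 + R) * (1 + R) * (‖w - b‖ - δ) :=
        mul_nonneg (by positivity) (by linarith)
      nlinarith
    refine h2.trans ?_
    gcongr

/-! ### Simultaneous approximation -/

/-- The algebra of restrictions to `X` of functions holomorphic on `Ω`. -/
def holoRestrict (X Ω : Set ℂ) : Subalgebra ℂ C(X, ℂ) where
  carrier := {c | ∃ G : ℂ → ℂ, DifferentiableOn ℂ G Ω ∧ ∀ z : X, c z = G z}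
  mul_mem' := by
    rintro _ _ ⟨G, hG, h⟩ ⟨G', hG', h'⟩
    exact ⟨_, hG.mul hG', fun z => by simp [h, h']⟩
  add_mem' := by
    rintro _ _ ⟨G, hG, h⟩ ⟨G', hG', h'⟩
    exact ⟨_, hG.add hG', fun z => by simp [h, h']⟩
  algebraMap_mem' c := ⟨fun _ => c, differentiableOn_const c, fun _ => rfl⟩

/-- On `L` the zero-free function `E - a` has a logarithm, which `φ` carries over to `E '' L`. -/
theorem hasLogOn_image_sub {D L : Set ℂ} (hD : IsOpen D) (hL : IsCompact L) (hLD : L ⊆ D)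
    (hlog : ∀ a ∉ L, HasLogOn L (fun z => z - a)) {E φ : ℂ → ℂ} (hE : DifferentiableOn ℂ E D)
    (hφ : ContinuousOn φ (E '' D)) (hφE : ∀ w ∈ D, φ (E w) = w) {a : ℂ} (ha : a ∉ E '' L) :
    HasLogOn (E '' L) (fun z => z - a) := by
  obtain ⟨l, hl, he⟩ := hasLogOn_of_differentiableOn hL hD hLD hlog
    (hE.sub (differentiableOn_const a)) fun z hz h => ha ⟨z, hz, sub_eq_zero.1 h⟩
  refine ⟨fun z => l (φ z), hl.comp (hφ.mono (image_mono hLD)) ?_, ?_⟩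
  · rintro _ ⟨w, hw, rfl⟩
    rwa [hφE w (hLD hw)]
  · rintro _ ⟨w, hw, rfl⟩
    simp only [hφE w (hLD hw), he w hw]
    rfl

theorem exists_inv_mem_holoRestrict {X Ω : Set ℂ} [CompactSpace X] (hXΩ : X ⊆ Ω)
    {b : ℂ} (hb : b ∉ Ω) : ∃ g ∈ holoRestrict X Ω, ∀ z : X, ((z : ℂ) - b) * g z = 1 := by
  have h0 : ∀ z ∈ Ω, z - b ≠ 0 := fun z hz h => hb (sub_eq_zero.1 h ▸ hz)
  refine ⟨⟨fun z : X => ((z : ℂ) - b)⁻¹,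
    Continuous.inv₀ (by fun_prop) fun z => h0 z (hXΩ z.2)⟩, ⟨fun z => (z - b)⁻¹,
      DifferentiableOn.inv (by fun_prop) h0, fun _ => rfl⟩, fun z => ?_⟩
  exact mul_inv_cancel₀ (h0 z (hXΩ z.2))

theorem exists_approx_of_disjoint {D Ω : Set ℂ} (hD : IsOpen D) (hDh : HasNoHoles D)
    (hΩ : IsOpen Ω) {E : ℂ → ℂ} (hE : DifferentiableOn ℂ E D) (hinj : InjOn E D)
    (hmaps : MapsTo E D Ω) {R δ R' δ' : ℝ} (hδ : 0 < δ) (hδ' : 0 < δ')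
    (hdisj : ∀ w ∈ core D R' δ', E w ∉ core Ω R δ) {g h : ℂ → ℂ} (hg : DifferentiableOn ℂ g Ω)
    (hh : DifferentiableOn ℂ h D) {ε : ℝ} (hε : 0 < ε) :
    ∃ G : ℂ → ℂ, DifferentiableOn ℂ G Ω ∧ (∀ z ∈ core Ω R δ, ‖G z - g z‖ < ε) ∧
      ∀ w ∈ core D R' δ', ‖G (E w) - h w‖ < ε := by
  classical
  set K := core Ω R δ with hKdef
  set L := core D R' δ' with hLdef
  have hK : IsCompact K := isCompact_core _ _ _
  have hL : IsCompact L := isCompact_core _ _ _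
  have hKΩ : K ⊆ Ω := core_subset _ _ hδ
  have hLD : L ⊆ D := core_subset _ _ hδ'
  obtain ⟨hopen, φ, hφ, hφE⟩ := exists_holomorphic_inverse hD hE hinj
  set M := E '' L with hMdef
  have hM : IsCompact M := hL.image_of_continuousOn (hE.continuousOn.mono hLD)
  have hKM : Disjoint K M := by
    rw [Set.disjoint_right]
    rintro _ ⟨w, hw, rfl⟩
    exact hdisj w hw
  have hMlog : ∀ a ∉ M, HasLogOn M (fun z => z - a) := fun a ha =>
    hasLogOn_image_sub hD hL hLD (fun a ha => hasLogOn_core_sub hDh hδ' ha) hE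
      hφ.continuousOn hφE ha
  set X := K ∪ M with hXdef
  have hX : IsCompact X := hK.union hM
  have hXΩ : X ⊆ Ω := union_subset hKΩ ((image_mono hLD).trans hmaps.image_subset)
  have : CompactSpace X := isCompact_iff_compactSpace.1 hX
  let A : Subalgebra ℂ C(X, ℂ) := (holoRestrict X Ω).topologicalClosure
  have hA : IsClosed (A : Set C(X, ℂ)) := Subalgebra.isClosed_topologicalClosure _
  have hSA : holoRestrict X Ω ≤ A := Subalgebra.le_topologicalClosure _
  have hinv : ∀ a ∉ X, ∃ g ∈ A, ∀ z : X, ((z : ℂ) - a) * g z = 1 := by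
    refine exists_inv_of_hasLogOn A hA
      (hSA ⟨fun z => z, differentiableOn_id, fun _ => rfl⟩) fun a ha => ?_
    have haM : a ∉ M := fun h => ha (Or.inr h)
    have haK : a ∉ K := fun h => ha (Or.inl h)
    -- Holes of `K` are allowed: `z - a` may lack a logarithm there, but dividing by `z - b` with `b
    -- ∉ Ω` repairs this, and `(z - b)⁻¹` is holomorphic on `Ω`.
    rcases norm_lt_or_exists_of_notMem_core haK with hn | ⟨b, hb, hn⟩
    · exact Or.inl ((HasLogOn.sub_of_norm_lt hn).union hK.isClosed hM.isClosed hKM (hMlog a haM))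
    · obtain ⟨q, hq, hqz⟩ := exists_inv_mem_holoRestrict hXΩ hb
      have hbM : b ∉ M := fun h => hb (hXΩ (Or.inr h))
      exact Or.inr ⟨b, ⟨q, hSA hq, hqz⟩, (HasLogOn.div_of_norm_lt hn).union hK.isClosed
        hM.isClosed hKM ((hMlog a haM).div (hMlog b hbM))⟩
  obtain ⟨U, V, hU, hV, hKU, hMV, hUV⟩ := SeparatedNhds.of_isCompact_isCompact hK hM hKM
  set F : ℂ → ℂ := U.piecewise g (h ∘ φ) with hF
  have hFU : EqOn F g U := piecewise_eqOn _ _ _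
  have hFV : EqOn F (h ∘ φ) V := (piecewise_eqOn_compl _ _ _).mono hUV.subset_compl_left
  have hφD : MapsTo φ (E '' D) D := by
    rintro _ ⟨w, hw, rfl⟩
    rwa [hφE w hw]
  have hFd : DifferentiableOn ℂ F (U ∩ Ω ∪ V ∩ E '' D) :=
    ((hg.mono inter_subset_right).congr (hFU.mono inter_subset_left)).union_of_isOpen
      (((hh.comp hφ hφD).mono inter_subset_right).congr (hFV.mono inter_subset_left))
      (hU.inter hΩ) (hV.inter hopen)
  have hsub : X ⊆ U ∩ Ω ∪ V ∩ E '' D :=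
    union_subset_union (subset_inter hKU hKΩ) (subset_inter hMV (image_mono hLD))
  have hmem := mem_of_differentiableOn ((hU.inter hΩ).union (hV.inter hopen)) hsub hFd A hA hinv
    ⟨X.domRestrict F, continuousOn_iff_continuous_domRestrict.1 (hFd.continuousOn.mono hsub)⟩
    fun _ => rfl
  obtain ⟨c, ⟨G, hG, hcG⟩, hcd⟩ := Metric.mem_closure_iff.1 hmem ε hε
  have hlt : ∀ z ∈ X, ‖G z - F z‖ < ε := by
    intro z hz
    have h1 := (ContinuousMap.dist_lt_iff hε).1 hcd ⟨z, hz⟩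
    rw [hcG, dist_comm, dist_eq_norm] at h1
    exact h1
  refine ⟨G, hG, fun z hz => ?_, fun w hw => ?_⟩
  · rw [← hFU (hKU hz)]
    exact hlt z (Or.inl hz)
  · have h1 := hlt (E w) (Or.inr ⟨w, hw, rfl⟩)
    rwa [hFV (hMV ⟨w, hw, rfl⟩), Function.comp_apply, hφE w (hLD hw)] at h1

/-! ### The space of holomorphic functions -/

theorem mem_nhds_continuousMap_iff {Y : Type*} [TopologicalSpace Y] {c : C(Y, ℂ)}
    {s : Set C(Y, ℂ)} : s ∈ 𝓝 c ↔ ∃ K : Set Y, IsCompact K ∧ ∃ ε > 0,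
      ∀ d : C(Y, ℂ), (∀ x ∈ K, ‖d x - c x‖ < ε) → d ∈ s := by
  rw [(nhds_basis_uniformity'
    ContinuousMap.hasBasis_compactConvergenceUniformity).mem_iff]
  constructor
  · rintro ⟨⟨K, V⟩, ⟨hK, hV⟩, hs⟩
    obtain ⟨ε, hε, h⟩ := Metric.mem_uniformity_dist.1 hV
    refine ⟨K, hK, ε, hε, fun d hd => hs fun x hx => h ?_⟩
    rw [dist_comm, dist_eq_norm]
    exact hd x hx
  · rintro ⟨K, hK, ε, hε, h⟩
    refine ⟨⟨K, {p | dist p.1 p.2 < ε}⟩, ⟨hK, Metric.dist_mem_uniformity hε⟩, fun d hd => ?_⟩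
    refine h d fun x hx => ?_
    have := hd x hx
    rwa [mem_ofPred_eq, dist_comm, dist_eq_norm] at this

/-- Weierstrass's theorem on locally uniform limits, applied to extensions by zero. -/
theorem isClosed_H {Ω : Set ℂ} (hΩ : IsOpen Ω) : IsClosed (H Ω) := by
  classical
  have := hΩ.locallyCompactSpace
  refine isClosed_of_closure_subset fun c hc => ?_
  have hne : (𝓝[H Ω] c).NeBot := mem_closure_iff_nhdsWithin_neBot.1 hc
  let ext0 : C(Ω, ℂ) → ℂ → ℂ := fun d z => if h : z ∈ Ω then d ⟨z, h⟩ else 0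
  have hext : ∀ (d : C(Ω, ℂ)) (z : Ω), ext0 d z = d z := fun d z => by simp [ext0]
  have h1 : TendstoLocallyUniformly (fun (d : C(Ω, ℂ)) (x : Ω) => d x) c (𝓝[H Ω] c) :=
    ContinuousMap.tendsto_iff_tendstoLocallyUniformly.1 (tendsto_id.mono_left nhdsWithin_le_nhds)
  have h2 : TendstoLocallyUniformlyOn ext0 (ext0 c) (𝓝[H Ω] c) Ω := by
    rw [tendstoLocallyUniformlyOn_iff_tendstoLocallyUniformly_comp_coe]
    have e2 : ext0 c ∘ (Subtype.val : Ω → ℂ) = c := funext fun z => hext c z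
    rw [e2]
    exact h1.congr fun d z => (hext d z).symm
  refine ⟨ext0 c, h2.differentiableOn ?_ hΩ, fun z => (hext c z).symm⟩
  filter_upwards [self_mem_nhdsWithin] with d hd
  obtain ⟨F, hF, hdF⟩ := hd
  exact hF.congr fun z hz => (hext d ⟨z, hz⟩).trans (hdF ⟨z, hz⟩)

theorem baireSpace_H {Ω : Set ℂ} (hΩ : IsOpen Ω) : BaireSpace (H Ω) := by
  have := hΩ.locallyCompactSpace
  have := (isClosed_H hΩ).completeSpace_coe
  infer_instance

/-! ### Iterates -/

variable {D Ω : Set ℂ} {f : C(D, D)} {E : ℂ → ℂ}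

theorem iter_eq_iterate (hE : ∀ z : D, (f z : ℂ) = E z) (n : ℕ) (z : D) :
    (iter f n z : ℂ) = E^[n] z := by
  change ((f^[n] z : D) : ℂ) = E^[n] z
  induction n with
  | zero => rfl
  | succ n ih => rw [Function.iterate_succ_apply', Function.iterate_succ_apply', hE, ih]

theorem mapsTo_of_eq (hE : ∀ z : D, (f z : ℂ) = E z) : MapsTo E D D := fun z hz => by
  rw [← hE ⟨z, hz⟩]
  exact (f ⟨z, hz⟩).2

theorem differentiableOn_iterate (hE : DifferentiableOn ℂ E D) (hm : MapsTo E D D) (n : ℕ) :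
    DifferentiableOn ℂ E^[n] D := by
  induction n with
  | zero => exact differentiableOn_id
  | succ n ih => exact ih.comp hE hm

theorem injOn_iterate (hE : ∀ z : D, (f z : ℂ) = E z) (hf : Function.Injective f) (n : ℕ) :
    InjOn E^[n] D := by
  have h1 : InjOn E D := fun z hz w hw h => by
    rw [← hE ⟨z, hz⟩, ← hE ⟨w, hw⟩] at h
    exact congrArg Subtype.val (hf (Subtype.ext h))
  exact h1.iterate (mapsTo_of_eq hE) n

/-- The distance to the boundary is bounded below on `K` but tends to zero uniformly along the
orbits from `L`. -/
theorem eventually_iterate_notMem (hD : IsOpen D) (hΩ : IsOpen Ω) (hne : Ω.Nonempty)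
    (hE : ∀ z : D, (f z : ℂ) = E z) (hlim : IteratesTendToBoundary f Ω) {K L : Set ℂ}
    (hK : IsCompact K) (hKΩ : K ⊆ Ω) (hL : IsCompact L) (hLD : L ⊆ D) :
    ∀ᶠ n in atTop, ∀ w ∈ L, E^[n] w ∉ K := by
  have := hD.locallyCompactSpace
  obtain ⟨c, hc, hcK⟩ := exists_pos_le_chordalDist hΩ hne hK hKΩ
  have hL' : IsCompact ((↑) ⁻¹' L : Set D) :=
    Topology.IsInducing.subtypeVal.isCompact_preimage_iff (by simpa using hLD) |>.2 hL
  have h1 := tendstoLocallyUniformly_iff_forall_isCompact.1 hlim _ hL'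
  filter_upwards [Metric.tendstoUniformlyOn_iff.1 h1 c hc] with n hn w hw hwK
  have h2 := hn ⟨w, hLD hw⟩ hw
  rw [iter_eq_iterate hE, dist_comm, Real.dist_eq, sub_zero] at h2
  exact absurd ((le_abs_self _).trans_lt h2) (hcK _ hwK).not_gt

/-! ### Universality is generic -/

/-- Topological transitivity of the sequence of composition operators. -/
theorem exists_compIter_mem (hD : IsOpen D) (hDh : HasNoHoles D) (hΩ : IsOpen Ω)
    (hne : Ω.Nonempty) (hDΩ : D ⊆ Ω) (hholo : IsHolo (fun z : D => (f z : ℂ)))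
    (hf : Function.Injective f) (hlim : IteratesTendToBoundary f Ω) (g : H Ω)
    {U : Set (H Ω)} (hU : U ∈ 𝓝 g) {h : C(D, ℂ)} (hh : h ∈ H D) {V : Set C(D, ℂ)}
    (hV : V ∈ 𝓝 h) :
    ∃ G ∈ U, ∃ n, 1 ≤ n ∧ compIter (Subset.refl D) hDΩ f (G : C(Ω, ℂ)) n ∈ V := by
  obtain ⟨E, hEd, hE⟩ := hholo
  obtain ⟨g₀, hg₀, hgg⟩ := g.2
  obtain ⟨h₀, hh₀, hhh⟩ := hh
  obtain ⟨U', hU', hUU⟩ := mem_nhds_induced _ _ _ |>.1 hU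
  obtain ⟨K, hK, ε, hε, hKU⟩ := mem_nhds_continuousMap_iff.1 hU'
  obtain ⟨L, hL, ε', hε', hLV⟩ := mem_nhds_continuousMap_iff.1 hV
  obtain ⟨R, δ, hδ, hKc⟩ := exists_subset_core hΩ (hK.image continuous_subtype_val)
    (Subtype.coe_image_subset _ _)
  obtain ⟨R', δ', hδ', hLc⟩ := exists_subset_core hD (hL.image continuous_subtype_val)
    (Subtype.coe_image_subset _ _)
  obtain ⟨n, hn, hn1⟩ := ((eventually_iterate_notMem hD hΩ hne hE hlim (isCompact_core Ω R δ)
    (core_subset _ _ hδ) (isCompact_core D R' δ') (core_subset _ _ hδ')).and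
      (eventually_ge_atTop 1)).exists
  have hm := mapsTo_of_eq hE
  obtain ⟨G, hG, hGg, hGh⟩ := exists_approx_of_disjoint hD hDh hΩ
    (differentiableOn_iterate hEd hm n) (injOn_iterate hE hf n) ((hm.iterate n).mono_right hDΩ)
    hδ hδ' hn hg₀ hh₀ (lt_min hε hε')
  let c : C(Ω, ℂ) := ⟨Ω.domRestrict G, continuousOn_iff_continuous_domRestrict.1 hG.continuousOn⟩
  have hc : ∀ z : Ω, c z = G z := fun _ => rfl
  refine ⟨⟨c, G, hG, hc⟩, hUU (hKU c fun x hx => ?_), n, hn1, hLV _ fun x hx => ?_⟩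
  · rw [hc, hgg]
    exact (hGg x (hKc ⟨x, hx, rfl⟩)).trans_le (min_le_left _ _)
  · have h1 := (hGh x (hLc ⟨x, hx, rfl⟩)).trans_le (min_le_right _ _)
    rw [← iter_eq_iterate hE n x, ← hhh x] at h1
    exact h1

theorem continuous_compIter (hDΩ : D ⊆ Ω) (n : ℕ) :
    Continuous fun g : H Ω => compIter (Subset.refl D) hDΩ f (g : C(Ω, ℂ)) n :=
  (ContinuousMap.continuous_precomp _).comp continuous_subtype_val

end HolUniversal

open HolUniversal

theorem mainTheorem3 (D Ω : Set ℂ)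
    (hD_open : IsOpen D) (hD_ne : D.Nonempty) (hD_holes : HolUniversal.HasNoHoles D)
    (hΩ_open : IsOpen Ω) (hΩ_conn : IsConnected Ω) (hDΩ : D ⊆ Ω)
    (f : C(D, D)) (hf_holo : HolUniversal.IsHolo (fun z : D => (f z : ℂ)))
    (hf_inj : Function.Injective f)
    (hf_lim : HolUniversal.IteratesTendToBoundary f Ω) :
    HolUniversal.IsComeager
      {g : HolUniversal.H Ω |
        HolUniversal.IsUniversal (Subset.refl D) hDΩ f (HolUniversal.H D) g} := by
  have := hD_open.locallyCompactSpace
  have := baireSpace_H hΩ_open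
  -- Closures are taken in `C(D, ℂ)`, so its basis is used; only members meeting `H D` must be hit.
  let 𝓑 := {V : Set C(D, ℂ) // V ∈ TopologicalSpace.countableBasis C(D, ℂ) ∧ (V ∩ H D).Nonempty}
  have : Countable 𝓑 :=
    ((TopologicalSpace.countable_countableBasis C(D, ℂ)).mono fun _ h => h.1).to_subtype
  let W : 𝓑 → Set (H Ω) := fun V =>
    {g | ∃ n, 1 ≤ n ∧ compIter (Subset.refl D) hDΩ f (g : C(Ω, ℂ)) n ∈ (V : Set C(D, ℂ))}
  have hWo : ∀ V, IsOpen (W V) := by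
    intro V
    have : W V = ⋃ n, ⋃ (_ : 1 ≤ n),
        {g : H Ω | compIter (Subset.refl D) hDΩ f (g : C(Ω, ℂ)) n ∈ (V : Set C(D, ℂ))} := by
      ext g
      simp [W]
    rw [this]
    exact isOpen_iUnion fun n => isOpen_iUnion fun _ =>
      (TopologicalSpace.isOpen_of_mem_countableBasis V.2.1).preimage (continuous_compIter hDΩ n)
  have hWd : ∀ V, Dense (W V) := by
    rintro ⟨V, hVb, h, hhV, hh⟩
    refine fun g => mem_closure_iff_nhds.2 fun U hU => ?_
    obtain ⟨G, hGU, n, hn, hGV⟩ := exists_compIter_mem hD_open hD_holes hΩ_open hΩ_conn.nonempty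
      hDΩ hf_holo hf_inj hf_lim g hU hh
      ((TopologicalSpace.isOpen_of_mem_countableBasis hVb).mem_nhds hhV)
    exact ⟨G, hGU, n, hn, hGV⟩
  refine ⟨⋂ V, W V, fun g hg h hh => ?_, .iInter_of_isOpen hWo, dense_iInter_of_isOpen hWo hWd⟩
  rw [(TopologicalSpace.isBasis_countableBasis C(D, ℂ)).mem_closure_iff]
  intro V hV hhV
  obtain ⟨n, hn, hm⟩ := mem_iInter.1 hg ⟨V, hV, h, hhV, hh⟩
  exact ⟨_, hm, n, hn, rfl⟩
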